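/- Let $\Gamma$ be a countable (discrete) amenable group, let $X$ be a compact metric space, and let $T:\Gamma\to\mathrm{Homeo}(X)$, $\gamma\mapsto T_\gamma$, be a group homomorphism. Let $\mathrm{Cov}(X)$ be the set of finite open covers of $X$, and write $\mathcal V\succeq\mathcal U$ if every element of $\mathcal V$ is contained in some element of $\mathcal U$. For a finite family $\mathcal V$ of subsets of $X$ put $\mathrm{ord}(\mathcal V,x)=-1+\sum_{V\in\mathcal V}\mathbf 1_V(x)$. Let $\mathrm{Prob}(X,T)$ be the set of $T$-invariant Borel probability measures on $X$, and define, with values in $[-\infty,+\infty]$, $$\dim(X,T)=\sup_{\mathcal U\in\mathrm{Cov}(X)}\ \inf_{\substack{\mathcal V\in\mathrm{Cov}(X)\\ \mathcal V\succeq\mathcal U}}\ \sup_{\mu\in\mathrm{Prob}(X,T)}\int_X\mathrm{ord}(\mathcal V,x)\,d\mu(x).$$ Let $(F_n)_{n}$ be any F\o lner sequence in $\Gamma$, that is, a sequence of nonempty finite subsets of $\Gamma$ with $|F_n\gamma\,\triangle\,F_n|/|F_n|\to0$ for every $\gamma\in\Gamma$ (for countable $\Gamma$, such a sequence exists exactly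 when $\Gamma$ is amenable). Let $\bigvee_{\gamma\in F_n}T_\gamma(\mathcal U)$ be the cover by all sets $\bigcap_{\gamma\in F_n}T_\gamma(U_\gamma)$ with $U_\gamma\in\mathcal U$, and let Gromov's mean dimension be $$\mathrm{mdim}(X,T)=\sup_{\mathcal U\in\mathrm{Cov}(X)}\ \limsup_{n\to\infty}\frac1{|F_n|}\ \inf_{\substack{\mathcal V\in\mathrm{Cov}(X)\\ \mathcal V\succeq\bigvee_{\gamma\in F_n}T_\gamma(\mathcal U)}}\ \sup_{x\in X}\ \mathrm{ord}(\mathcal V,x)$$ (the limit superior is in fact a limit, and does not depend on the choice of the F\o lner sequence, by the Ornstein--Weiss lemma). Then $$\mathrm{mdim}(X,T)\le\dim(X,T).$$ -/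

import Mathlib

open MeasureTheory Filter Topology
open scoped symmDiff Pointwise

noncomputable section

namespace DynDim

/-- The set `Cov(X)` of finite open covers of `X`. -/
def Cov (X : Type*) [TopologicalSpace X] : Set (Finset (Set X)) :=
  {𝒰 | (∀ U ∈ 𝒰, IsOpen U) ∧ ∀ x : X, ∃ U ∈ 𝒰, x ∈ U}

/-- `𝒱` refines `𝒰`: every member of `𝒱` is contained in some member of `𝒰`. -/
def Refines {X : Type*} (𝒱 𝒰 : Set (Set X)) : Prop :=
  ∀ V ∈ 𝒱, ∃ U ∈ 𝒰, V ⊆ U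

/-- The order of a finite family at a point: `ord(𝒱, x) = -1 + ∑_{V ∈ 𝒱} 1_V(x)`. -/
def ordAt {X : Type*} (𝒱 : Finset (Set X)) (x : X) : ℝ :=
  -1 + ∑ V ∈ 𝒱, V.indicator (fun _ => (1 : ℝ)) x

/-- The order `ord(𝒱) = sup_x ord(𝒱, x)` (it is `-∞` if `X` is empty). -/
def ord {X : Type*} (𝒱 : Finset (Set X)) : EReal :=
  ⨆ x : X, (ordAt 𝒱 x : EReal)

/-- The dimension of a cover: the infimum of `ord(𝒱)` over the finite open covers `𝒱`
that refine `𝒰`. -/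
def coverDim {X : Type*} [TopologicalSpace X] (𝒰 : Set (Set X)) : EReal :=
  ⨅ 𝒱 ∈ {𝒱 : Finset (Set X) | 𝒱 ∈ Cov X ∧ Refines (𝒱 : Set (Set X)) 𝒰}, ord 𝒱

/-- The order of a finite family relative to a set `P` of Borel probability measures:
`ord(𝒱, P) = sup_{μ ∈ P} ∫ ord(𝒱, x) dμ(x)` (it is `-∞` if `P` is empty). -/
def ordMeas {X : Type*} [MeasurableSpace X]
    (𝒱 : Finset (Set X)) (P : Set (ProbabilityMeasure X)) : EReal :=
  ⨆ μ ∈ P, ((∫ x, ordAt 𝒱 x ∂(μ : Measure X) : ℝ) : EReal)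

/-- `dim(𝒰, P)`: the infimum of `ord(𝒱, P)` over the finite open covers `𝒱` that refine `𝒰`. -/
def coverDimMeas {X : Type*} [TopologicalSpace X] [MeasurableSpace X]
    (𝒰 : Set (Set X)) (P : Set (ProbabilityMeasure X)) : EReal :=
  ⨅ 𝒱 ∈ {𝒱 : Finset (Set X) | 𝒱 ∈ Cov X ∧ Refines (𝒱 : Set (Set X)) 𝒰}, ordMeas 𝒱 P

/-- The dimension `dim(X, P)` of a topological-measure pair. -/
def pairDim {X : Type*} [TopologicalSpace X] [MeasurableSpace X]
    (P : Set (ProbabilityMeasure X)) : EReal :=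
  ⨆ 𝒰 ∈ Cov X, coverDimMeas (𝒰 : Set (Set X)) P

/-- The set `Prob(X, T)` of `T`-invariant Borel probability measures. -/
def invProb {Γ X : Type*} [Group Γ] [TopologicalSpace X] [MeasurableSpace X]
    (T : Γ →* (X ≃ₜ X)) : Set (ProbabilityMeasure X) :=
  {μ | ∀ γ : Γ, MeasurePreserving (T γ) (μ : Measure X) (μ : Measure X)}

/-- The dimension `dim(X, T) = dim(X, Prob(X, T))` of a dynamical system. -/
def dynDim {Γ X : Type*} [Group Γ] [TopologicalSpace X] [MeasurableSpace X]
    (T : Γ →* (X ≃ₜ X)) : EReal :=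
  pairDim (invProb T)

/-- The joint refinement `⋁_{γ ∈ F} T_γ(𝒰)`: all sets `⋂_{γ ∈ F} T_γ(U_γ)` with `U_γ ∈ 𝒰`. -/
def joinIterates {Γ X : Type*} [Group Γ] [TopologicalSpace X]
    (T : Γ →* (X ≃ₜ X)) (F : Finset Γ) (𝒰 : Set (Set X)) : Set (Set X) :=
  {W | ∃ u : Γ → Set X, (∀ γ ∈ F, u γ ∈ 𝒰) ∧ W = ⋂ γ ∈ F, T γ '' u γ}

/-- A Følner sequence of nonempty finite subsets of `Γ`: `|F_n γ ∆ F_n| / |F_n| → 0` for every `γ`.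
The translates are on the right because mean dimension is written with `T_γ(𝒰)`: the function
`F ↦ dim(⋁_{γ ∈ F} T_γ(𝒰))` is invariant under translation of `F` on the left. Taking inverses
exchanges this with the convention `|γ F_n ∆ F_n| / |F_n| → 0` and covers `T_γ⁻¹(𝒰)`. -/
structure IsFolnerSeq {Γ : Type*} [Group Γ] (F : ℕ → Finset Γ) : Prop where
  nonempty : ∀ n, (F n).Nonempty
  tendsto : ∀ γ : Γ, Tendsto
    (fun n => ((((fun g => g * γ) '' (F n : Set Γ)) ∆ (F n : Set Γ)).ncard : ℝ) / (F n).card)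
    atTop (𝓝 0)

/-- Gromov's mean dimension
`mdim(X, T) = sup_𝒰 lim_n |F_n|⁻¹ dim(⋁_{γ ∈ F_n} T_γ(𝒰))` along a Følner sequence `F`.
The limit is written as a limit superior, which needs no proof that it exists and is equal to
the limit whenever there is one. -/
def mdim {Γ X : Type*} [Group Γ] [TopologicalSpace X]
    (T : Γ →* (X ≃ₜ X)) (F : ℕ → Finset Γ) : EReal :=
  ⨆ 𝒰 ∈ Cov X, limsup
    (fun n => coverDim (joinIterates T (F n) (𝒰 : Set (Set X))) / ((F n).card : EReal)) atTop

end DynDim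

end

namespace DynDim

universe u

/-! Given a cover `𝒰` and a real `c` above the dimension, choose `𝒱` refining `𝒰` whose order
integrates to less than `c` against every invariant measure. A partition of unity subordinate to `𝒱`
has order (the number of positive members, minus one) below a continuous `G ≤ ordAt 𝒱`. Two ideas
finish. Topologically, orders of partitions of unity add: cutting `[0,1]` into `a` and into `b`
intervals gives a common subdivision with at most `a + b - 1` pieces, not `a * b`. Coupling the
translates over `F n` this way bounds the cover dimension by the supremum over `x` of `∑ γ ∈ F n, G
(T γ⁻¹ x)` (`coverDim_joinIterates_le`). Dynamically, weak limits of empirical measures along a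
Følner sequence are invariant, so these sums are eventually below `c * |F n|`, uniformly in `x`
(`eventually_forall_average_lt`). Continuity of `G` matters here: `ordAt 𝒱` is only lower
semicontinuous, the wrong direction for passing to the limit. -/

/-- The number of elements of `C` that come strictly before `a` in the order pulled back
along `t`. -/
def rankIn {α : Type*} (t : α → ℕ) (C : Finset α) (a : α) : ℕ :=
  (C.filter fun c => t c < t a).card

theorem rankIn_mono {α : Type*} (t : α → ℕ) (C : Finset α) {a b : α} (hab : t a ≤ t b) :
    rankIn t C a ≤ rankIn t C b := by
  apply Finset.card_le_card
  intro c hc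
  simp only [Finset.mem_filter] at hc ⊢
  exact ⟨hc.1, by omega⟩

theorem rankIn_lt_rankIn {α : Type*} (t : α → ℕ) {C : Finset α} {a b : α} (ha : a ∈ C)
    (hab : t a < t b) : rankIn t C a < rankIn t C b := by
  apply Finset.card_lt_card
  refine Finset.ssubset_iff_subset_ne.2 ⟨?_, fun h => ?_⟩
  · intro c hc
    simp only [Finset.mem_filter] at hc ⊢
    exact ⟨hc.1, by omega⟩
  · have : a ∈ C.filter (fun c => t c < t a) := by
      rw [h]; simp [ha, hab]
    simp at this

theorem rankIn_lt_card {α : Type*} (t : α → ℕ) {C : Finset α} {a : α} (ha : a ∈ C) :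
    rankIn t C a < C.card :=
  Finset.card_lt_card (Finset.filter_ssubset.2 ⟨a, ha, by simp⟩)

/-- A chain in a product of two finite nonempty linearly ordered sets `A`, `B` has at most
`|A| + |B| - 1` elements. The orders are given by injections to `ℕ`. -/
theorem card_chain_add_one_le {ι κ : Type*} (r : ι → ℕ) (s : κ → ℕ)
    (hr : Function.Injective r) (hs : Function.Injective s)
    (A : Finset ι) (B : Finset κ) (S : Finset (ι × κ)) (hA : A.Nonempty) (hB : B.Nonempty)
    (hS : ∀ p ∈ S, p.1 ∈ A ∧ p.2 ∈ B)
    (hchain : ∀ p ∈ S, ∀ q ∈ S, r p.1 < r q.1 → s p.2 ≤ s q.2) :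
    S.card + 1 ≤ A.card + B.card := by
  have hcard : S.card ≤ (Finset.range (A.card + B.card - 1)).card := by
    -- The sum of the two ranks increases strictly along the chain and lies between `0` and `|A| +
    -- |B| - 2`.
    refine Finset.card_le_card_of_injOn
      (fun p => rankIn r A p.1 + rankIn s B p.2)
      ?_ ?_
    · intro p hp
      have h1 := rankIn_lt_card r (hS p hp).1
      have h2 := rankIn_lt_card s (hS p hp).2
      simp only [Finset.coe_range, Set.mem_Iio]
      omega
    · have key : ∀ p ∈ S, ∀ q ∈ S, r p.1 < r q.1 ∨ (r p.1 = r q.1 ∧ s p.2 < s q.2) →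
          rankIn r A p.1 + rankIn s B p.2 <
          rankIn r A q.1 + rankIn s B q.2 := by
        rintro p hp q hq (h | ⟨h1, h2⟩)
        · have h3 := rankIn_lt_rankIn r (hS p hp).1 h
          have h4 := rankIn_mono s B (hchain p hp q hq h)
          omega
        · have h3 := rankIn_mono r A h1.le
          have h4 := rankIn_lt_rankIn s (hS p hp).2 h2
          omega
      intro p hp q hq hpq
      have h1 := key p hp q hq
      have h2 := key q hq p hp
      simp only at hpq
      refine Prod.ext (hr ?_) (hs ?_)
      · by_contra hne
        rcases lt_or_gt_of_ne hne with h | h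
        · exact absurd hpq (h1 (Or.inl h)).ne
        · exact absurd hpq (h2 (Or.inl h)).ne'
      · by_contra hne
        rcases lt_trichotomy (r p.1) (r q.1) with h | h | h
        · exact absurd hpq (h1 (Or.inl h)).ne
        · rcases lt_or_gt_of_ne hne with h' | h'
          · exact absurd hpq (h1 (Or.inr ⟨h, h'⟩)).ne
          · exact absurd hpq (h2 (Or.inr ⟨h.symm, h'⟩)).ne'
        · exact absurd hpq (h2 (Or.inl h)).ne'
  rw [Finset.card_range] at hcard
  have := hA.card_pos
  have := hB.card_pos
  omega

/-! ### Coupling of partitions of unity -/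

/-- The sum of `f` over the indices that precede position `n` in a fixed enumeration of `ι`. -/
noncomputable def cumSum {X ι : Type*} [Fintype ι] (f : ι → X → ℝ) (n : ℕ) (x : X) : ℝ :=
  ∑ i with (Fintype.equivFin ι i : ℕ) < n, f i x

section cumSum

variable {X ι : Type*} [Fintype ι] (f : ι → X → ℝ)

theorem cumSum_zero (x : X) : cumSum f 0 x = 0 := by simp [cumSum]

theorem cumSum_card (x : X) : cumSum f (Fintype.card ι) x = ∑ i, f i x := by
  simp [cumSum]

theorem cumSum_succ (i : ι) (x : X) :
    cumSum f (Fintype.equivFin ι i + 1) x = cumSum f (Fintype.equivFin ι i) x + f i x := by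
  classical
  unfold cumSum
  have : (Finset.univ.filter fun k => (Fintype.equivFin ι k : ℕ) < Fintype.equivFin ι i + 1) =
      insert i (Finset.univ.filter fun k => (Fintype.equivFin ι k : ℕ) < Fintype.equivFin ι i) := by
    ext k
    simp only [Finset.mem_filter, Finset.mem_univ, true_and, Finset.mem_insert]
    rw [Nat.lt_succ_iff_lt_or_eq, or_comm, ← Fin.ext_iff, (Fintype.equivFin ι).injective.eq_iff]
  rw [this, Finset.sum_insert (by simp), add_comm]

theorem cumSum_mono (hf : ∀ i x, 0 ≤ f i x) (x : X) : Monotone fun n => cumSum f n x := by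
  intro m n hmn
  apply Finset.sum_le_sum_of_subset_of_nonneg
  · intro k hk
    simp only [Finset.mem_filter] at hk ⊢
    exact ⟨hk.1, by omega⟩
  · exact fun i _ _ => hf i x

theorem continuous_cumSum [TopologicalSpace X] (hf : ∀ i, Continuous (f i)) (n : ℕ) :
    Continuous (cumSum f n) :=
  continuous_finsetSum _ fun i _ => hf i

theorem sum_cumSum_telescope (φ : ℝ → ℝ) (x : X) :
    ∑ i, (φ (cumSum f (Fintype.equivFin ι i + 1) x) - φ (cumSum f (Fintype.equivFin ι i) x)) =
      φ (∑ i, f i x) - φ 0 := by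
  rw [(Fintype.equivFin ι).sum_comp (fun k : Fin (Fintype.card ι) =>
    φ (cumSum f (k + 1) x) - φ (cumSum f k x)),
    Fin.sum_univ_eq_sum_range (fun k => φ (cumSum f (k + 1) x) - φ (cumSum f k x)),
    Finset.sum_range_sub (fun k => φ (cumSum f k x)), cumSum_card, cumSum_zero]

end cumSum

theorem ncard_setOf_eq_card_filter {α : Type*} [Fintype α] (P : α → Prop) [DecidablePred P] :
    {a | P a}.ncard = (Finset.univ.filter P).card := by
  rw [← Set.ncard_coe_finset]
  simp

theorem filter_pos_nonempty {α : Type*} [Fintype α] {u : α → ℝ} (hu : ∑ a, u a = 1)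
    [DecidablePred fun a => 0 < u a] : (Finset.univ.filter fun a => 0 < u a).Nonempty := by
  by_contra hcon
  rw [Finset.not_nonempty_iff_eq_empty, Finset.filter_eq_empty_iff] at hcon
  have : ∑ a, u a ≤ 0 := Finset.sum_nonpos fun a ha => not_lt.1 (hcon ha)
  linarith

/-- Monotone coupling of two partitions of unity: the cells `(i, j)` are the intersections of
the consecutive intervals of lengths `f i x` with those of lengths `g j x`. The number of
nonempty cells at each point is at most the sum of the numbers of nonempty intervals, minus one. -/
theorem exists_coupling {X ι κ : Type*} [TopologicalSpace X] [Fintype ι] [Fintype κ]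
    (f : ι → X → ℝ) (g : κ → X → ℝ)
    (hfc : ∀ i, Continuous (f i)) (hgc : ∀ j, Continuous (g j))
    (hf0 : ∀ i x, 0 ≤ f i x) (hg0 : ∀ j x, 0 ≤ g j x)
    (hf1 : ∀ x, ∑ i, f i x = 1) (hg1 : ∀ x, ∑ j, g j x = 1) :
    ∃ h : ι × κ → X → ℝ, (∀ p, Continuous (h p)) ∧ (∀ p x, 0 ≤ h p x) ∧
      (∀ x, ∑ p, h p x = 1) ∧ (∀ p x, 0 < h p x → 0 < f p.1 x ∧ 0 < g p.2 x) ∧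
      ∀ x, {p | 0 < h p x}.ncard + 1 ≤ {i | 0 < f i x}.ncard + {j | 0 < g j x}.ncard := by
  classical
  let r : ι → ℕ := fun i => Fintype.equivFin ι i
  let s : κ → ℕ := fun j => Fintype.equivFin κ j
  -- `c i x` clamps to the `i`-th interval of `f`. Its increment over an interval of `g` is the
  -- length of the overlap, which is continuous in `x` and telescopes over `j`.
  let c : ι → X → ℝ → ℝ := fun i x u => max (cumSum f (r i) x) (min (cumSum f (r i + 1) x) u)
  let h : ι × κ → X → ℝ := fun p x =>
    c p.1 x (cumSum g (s p.2 + 1) x) - c p.1 x (cumSum g (s p.2) x)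
  have fle : ∀ i x, cumSum f (r i) x ≤ cumSum f (r i + 1) x := fun i x =>
    cumSum_mono f hf0 x (Nat.le_succ _)
  have gle : ∀ j x, cumSum g (s j) x ≤ cumSum g (s j + 1) x := fun j x =>
    cumSum_mono g hg0 x (Nat.le_succ _)
  have hpos : ∀ p x, 0 < h p x → cumSum f (r p.1) x < cumSum f (r p.1 + 1) x ∧
      cumSum g (s p.2) x < cumSum g (s p.2 + 1) x ∧
      cumSum f (r p.1) x < cumSum g (s p.2 + 1) x ∧
      cumSum g (s p.2) x < cumSum f (r p.1 + 1) x := by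
    intro p x hp
    have hp' := sub_pos.1 hp
    simp only [c] at hp'
    have h1 := fle p.1 x
    have h2 := gle p.2 x
    refine ⟨?_, ?_, ?_, ?_⟩ <;> by_contra! hcon <;> grind
  have hfg : ∀ p x, 0 < h p x → 0 < f p.1 x ∧ 0 < g p.2 x := by
    intro p x hp
    obtain ⟨h1, h2, -, -⟩ := hpos p x hp
    have e1 := cumSum_succ f p.1 x
    have e2 := cumSum_succ g p.2 x
    exact ⟨by simp only [r] at h1; linarith, by simp only [s] at h2; linarith⟩
  have f_le_one : ∀ i x, cumSum f (r i + 1) x ≤ 1 := by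
    intro i x
    rw [← hf1 x, ← cumSum_card]
    exact cumSum_mono f hf0 x (Fintype.equivFin ι i).2
  have f_nonneg : ∀ i x, 0 ≤ cumSum f (r i) x := fun i x => Finset.sum_nonneg fun k _ => hf0 k x
  refine ⟨h, fun p => ?_, fun p x => ?_, fun x => ?_, hfg, fun x => ?_⟩
  · have h1 := continuous_cumSum f hfc (r p.1)
    have h2 := continuous_cumSum f hfc (r p.1 + 1)
    have h3 := continuous_cumSum g hgc (s p.2)
    have h4 := continuous_cumSum g hgc (s p.2 + 1)
    exact (h1.max (h2.min h4)).sub (h1.max (h2.min h3))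
  · exact sub_nonneg.2 (max_le_max le_rfl (min_le_min le_rfl (gle p.2 x)))
  · rw [Fintype.sum_prod_type, ← hf1 x]
    refine Finset.sum_congr rfl fun i _ => ?_
    have := sum_cumSum_telescope g (c i x) x
    rw [hg1] at this
    refine this.trans ?_
    have h1 := fle i x
    have h2 := f_le_one i x
    have h3 := f_nonneg i x
    have h4 : cumSum f (r i + 1) x = cumSum f (r i) x + f i x := cumSum_succ f i x
    simp only [c]
    rw [min_eq_left h2, max_eq_right h1, min_eq_right (h3.trans h1), max_eq_left h3, h4]
    ring
  · rw [ncard_setOf_eq_card_filter, ncard_setOf_eq_card_filter, ncard_setOf_eq_card_filter]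
    refine card_chain_add_one_le r s
      (Fin.val_injective.comp (Fintype.equivFin ι).injective)
      (Fin.val_injective.comp (Fintype.equivFin κ).injective) _ _ _
      (filter_pos_nonempty (hf1 x)) (filter_pos_nonempty (hg1 x))
      (fun p hp => by simpa using hfg p x (by simpa using hp)) ?_
    -- Overlapping intervals each start before the other ends, so the cells met cannot move forward
    -- in `f` and backward in `g`.
    intro p hp q hq hpq
    simp only [Finset.mem_filter, Finset.mem_univ, true_and] at hp hq
    obtain ⟨-, -, -, h1⟩ := hpos p x hp
    obtain ⟨-, -, h2, -⟩ := hpos q x hq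
    by_contra! hcon
    have h3 : cumSum f (r p.1 + 1) x ≤ cumSum f (r q.1) x := cumSum_mono f hf0 x hpq
    have h4 : cumSum g (s q.2 + 1) x ≤ cumSum g (s p.2) x := cumSum_mono g hg0 x hcon
    linarith

/-- Iterated coupling of finitely many partitions of unity. -/
theorem exists_iterated_coupling {X Γ : Type*} {ι : Type u} [TopologicalSpace X] [Fintype ι]
    (F : Finset Γ) (f : Γ → ι → X → ℝ) (hfc : ∀ γ i, Continuous (f γ i))
    (hf0 : ∀ γ i x, 0 ≤ f γ i x) (hf1 : ∀ γ x, ∑ i, f γ i x = 1) :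
    ∃ (κ : Type u) (_ : Fintype κ) (h : κ → X → ℝ), (∀ k, Continuous (h k)) ∧
      (∀ k x, 0 ≤ h k x) ∧ (∀ x, ∑ k, h k x = 1) ∧
      (∀ γ ∈ F, ∀ k, ∃ i, ∀ x, 0 < h k x → 0 < f γ i x) ∧
      ∀ x, ({k | 0 < h k x}.ncard : ℝ) - 1 ≤ ∑ γ ∈ F, (({i | 0 < f γ i x}.ncard : ℝ) - 1) := by
  classical
  induction F using Finset.induction_on with
  | empty =>
    refine ⟨PUnit, inferInstance, fun _ _ => 1, fun _ => continuous_const, fun _ _ => zero_le_one,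
      by simp, by simp, fun x => ?_⟩
    simp [Set.ncard_univ]
  | insert γ F hγ ih =>
    obtain ⟨κ, _, h, hc, h0, h1, href, hcard⟩ := ih
    obtain ⟨h', hc', h0', h1', hpos, hcard'⟩ :=
      exists_coupling (f γ) h (hfc γ) hc (hf0 γ) h0 (hf1 γ) h1
    refine ⟨ι × κ, inferInstance, h', hc', h0', h1', fun η hη p => ?_, fun x => ?_⟩
    · rcases Finset.mem_insert.1 hη with rfl | hη
      · exact ⟨p.1, fun x hx => (hpos p x hx).1⟩
      · obtain ⟨i, hi⟩ := href η hη p.2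
        exact ⟨i, fun x hx => hi x (hpos p x hx).2⟩
    · rw [Finset.sum_insert hγ]
      have h2 := hcard x
      have h3 : (({p | 0 < h' p x}.ncard : ℝ)) + 1 ≤
        ({i | 0 < f γ i x}.ncard : ℝ) + ({j | 0 < h j x}.ncard : ℝ) := by exact_mod_cast hcard' x
      linarith

/-- A finite open cover `𝒱` of a normal space has a subordinate partition of unity whose pointwise
order is dominated by a continuous function `G`, itself dominated by the order of `𝒱`. -/
theorem exists_partition_of_mem_cov {X : Type*} [TopologicalSpace X] [NormalSpace X]
    {𝒱 : Finset (Set X)} (h𝒱 : 𝒱 ∈ Cov X) :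
    ∃ (f : 𝒱 → X → ℝ) (G : C(X, ℝ)), (∀ V, Continuous (f V)) ∧ (∀ V x, 0 ≤ f V x) ∧
      (∀ x, ∑ V, f V x = 1) ∧ (∀ V x, 0 < f V x → x ∈ (V : Set X)) ∧
      ∀ x, ({V | 0 < f V x}.ncard : ℝ) - 1 ≤ G x ∧ G x ≤ ordAt 𝒱 x := by
  classical
  obtain ⟨f, hf⟩ := PartitionOfUnity.exists_isSubordinate_of_locallyFinite (X := X)
    isClosed_univ (fun V : 𝒱 => (V : Set X)) (fun V => h𝒱.1 V V.2)
    (locallyFinite_of_finite _) (fun x _ => by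
      obtain ⟨U, hU, hx⟩ := h𝒱.2 x
      exact Set.mem_iUnion.2 ⟨⟨U, hU⟩, hx⟩)
  -- Urysohn functions squeezed between the indicators of `tsupport (f V)` and of `V`; `G` is their
  -- sum minus one.
  have hg : ∀ V : 𝒱, ∃ g : C(X, ℝ), Set.EqOn g 0 (V : Set X)ᶜ ∧ Set.EqOn g 1 (tsupport (f V)) ∧
      ∀ x, g x ∈ Set.Icc (0 : ℝ) 1 := fun V =>
    exists_continuous_zero_one_of_isClosed (h𝒱.1 V V.2).isClosed_compl (isClosed_tsupport _)
      (Set.disjoint_left.2 fun x hx hx' => hx (hf V hx'))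
  choose g g0 g1 g01 using hg
  have hGx : ∀ x, (-1 + ∑ V, g V : C(X, ℝ)) x = -1 + ∑ V, g V x := fun x => by simp
  refine ⟨fun V x => f V x, -1 + ∑ V, g V, fun V => (f V).continuous, fun V x => f.nonneg V x,
    fun x => ?_, fun V x hx => hf V (subset_tsupport _ hx.ne'), fun x => ⟨?_, ?_⟩⟩
  · rw [← finsum_eq_sum_of_fintype]
    exact f.sum_eq_one (Set.mem_univ x)
  · rw [hGx, ncard_setOf_eq_card_filter, Finset.card_filter]
    push_cast
    have : ∑ V, (if 0 < f V x then (1 : ℝ) else 0) ≤ ∑ V, g V x := by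
      refine Finset.sum_le_sum fun V _ => ?_
      split_ifs with h
      · exact (g1 V (subset_tsupport _ h.ne')).ge
      · exact (g01 V x).1
    linarith
  · rw [hGx, ordAt]
    gcongr
    rw [← Finset.sum_coe_sort 𝒱]
    refine Finset.sum_le_sum fun V _ => ?_
    by_cases hx : x ∈ (V : Set X)
    · simpa [hx] using (g01 V x).2
    · simpa [hx] using (g0 V hx).le

/-! ### Dimension of the joined covers -/

theorem mem_image_iff_inv {Γ X : Type*} [Group Γ] [TopologicalSpace X] (T : Γ →* (X ≃ₜ X)) (γ : Γ)
    (U : Set X) (x : X) : x ∈ T γ '' U ↔ T γ⁻¹ x ∈ U := by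
  rw [map_inv]
  constructor
  · rintro ⟨y, hy, rfl⟩
    have : (T γ)⁻¹ (T γ y) = y := (T γ).symm_apply_apply y
    rwa [this]
  · intro h
    exact ⟨_, h, (T γ).apply_symm_apply x⟩

theorem coverDim_joinIterates_le {Γ X : Type*} [Group Γ] [TopologicalSpace X]
    (T : Γ →* (X ≃ₜ X)) (F : Finset Γ) {𝒰 𝒱 : Finset (Set X)}
    (href : Refines (𝒱 : Set (Set X)) 𝒰)
    (f : 𝒱 → X → ℝ) (hfc : ∀ V, Continuous (f V)) (hf0 : ∀ V x, 0 ≤ f V x)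
    (hf1 : ∀ x, ∑ V, f V x = 1) (hfV : ∀ V x, 0 < f V x → x ∈ (V : Set X))
    (G : X → ℝ) (hG : ∀ x, ({V | 0 < f V x}.ncard : ℝ) - 1 ≤ G x)
    (c : ℝ) (hc : ∀ x, ∑ γ ∈ F, G (T γ⁻¹ x) ≤ c) :
    coverDim (joinIterates T F (𝒰 : Set (Set X))) ≤ c := by
  classical
  obtain ⟨κ, _, h, hcont, h0, h1, hsub, hcard⟩ := exists_iterated_coupling F
    (fun γ V x => f V (T γ⁻¹ x)) (fun γ V => (hfc V).comp (T γ⁻¹).continuous)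
    (fun γ V x => hf0 V _) (fun γ x => hf1 _)
  let 𝒲 : Finset (Set X) := Finset.univ.image fun k => {x | 0 < h k x}
  have h𝒲 : 𝒲 ∈ Cov X := by
    refine ⟨fun W hW => ?_, fun x => ?_⟩
    · obtain ⟨k, -, rfl⟩ := Finset.mem_image.1 hW
      exact isOpen_lt continuous_const (hcont k)
    · obtain ⟨k, hk⟩ := filter_pos_nonempty (h1 x)
      exact ⟨_, Finset.mem_image_of_mem _ (Finset.mem_univ k), (Finset.mem_filter.1 hk).2⟩
  have h𝒲ref : Refines (𝒲 : Set (Set X)) (joinIterates T F (𝒰 : Set (Set X))) := by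
    intro W hW
    obtain ⟨k, -, rfl⟩ := Finset.mem_image.1 (Finset.mem_coe.1 hW)
    have hu : ∀ γ, ∃ U : Set X, γ ∈ F → U ∈ 𝒰 ∧ ∀ x, 0 < h k x → T γ⁻¹ x ∈ U := by
      intro γ
      by_cases hγ : γ ∈ F
      · obtain ⟨V, hV⟩ := hsub γ hγ k
        obtain ⟨U, hU, hVU⟩ := href V V.2
        exact ⟨U, fun _ => ⟨hU, fun x hx => hVU (hfV V _ (hV x hx))⟩⟩
      · exact ⟨∅, fun h => absurd h hγ⟩
    choose u hu using hu
    refine ⟨⋂ γ ∈ F, T γ '' u γ, ⟨u, fun γ hγ => (hu γ hγ).1, rfl⟩, fun x hx => ?_⟩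
    simp only [Set.mem_iInter]
    exact fun γ hγ => (mem_image_iff_inv T γ _ x).2 ((hu γ hγ).2 x hx)
  refine (iInf₂_le 𝒲 ⟨h𝒲, h𝒲ref⟩).trans (iSup_le fun x => EReal.coe_le_coe_iff.2 ?_)
  -- Only an inequality: distinct `k` may give the same set.
  have hle : ∑ W ∈ 𝒲, W.indicator (fun _ => (1 : ℝ)) x ≤ ({k | 0 < h k x}.ncard : ℝ) := by
    rw [ncard_setOf_eq_card_filter, Finset.card_filter]
    push_cast
    refine (Finset.sum_image_le_of_nonneg (fun W _ => Set.indicator_nonneg (by simp) x)).trans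
      (Finset.sum_le_sum fun k _ => ?_)
    simp [Set.indicator]
  have h2 := hcard x
  have h3 : ∑ γ ∈ F, (({V | 0 < f V (T γ⁻¹ x)}.ncard : ℝ) - 1) ≤ ∑ γ ∈ F, G (T γ⁻¹ x) :=
    Finset.sum_le_sum fun γ _ => hG _
  have h4 := hc x
  simp only [ordAt]
  linarith

/-! ### Empirical measures and invariance -/

/-- The uniform probability measure on the finite orbit piece `T γ⁻¹ x`, `γ ∈ F`. -/
noncomputable def empirical {Γ X : Type*} [Group Γ] [TopologicalSpace X] [MeasurableSpace X]
    (T : Γ →* (X ≃ₜ X)) (F : Finset Γ) (x : X) : Measure X :=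
  (F.card : ENNReal)⁻¹ • ∑ γ ∈ F, Measure.dirac (T γ⁻¹ x)

theorem isProbabilityMeasure_empirical {Γ X : Type*} [Group Γ] [TopologicalSpace X]
    [MeasurableSpace X] (T : Γ →* (X ≃ₜ X)) {F : Finset Γ} (hF : F.Nonempty) (x : X) :
    IsProbabilityMeasure (empirical T F x) := by
  constructor
  simp only [empirical, Measure.smul_apply, Measure.coe_finsetSum, Finset.sum_apply,
    measure_univ, Finset.sum_const, nsmul_eq_mul, mul_one, smul_eq_mul]
  exact ENNReal.inv_mul_cancel (by simpa using hF.ne_empty) (by simp)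

theorem integral_empirical {Γ X : Type*} [Group Γ] [TopologicalSpace X] [MeasurableSpace X]
    [MeasurableSingletonClass X] (T : Γ →* (X ≃ₜ X)) (F : Finset Γ) (x : X) (φ : X → ℝ) :
    ∫ y, φ y ∂(empirical T F x) = (F.card : ℝ)⁻¹ * ∑ γ ∈ F, φ (T γ⁻¹ x) := by
  rw [empirical, integral_smul_measure, integral_finsetSum_measure]
  · simp
  · intro γ _
    exact integrable_dirac (by simp)

/-- Averages over `F` change little under the right translation `γ ↦ γ * η`. -/
theorem abs_average_translate_sub_le {Γ X : Type*} [Group Γ] [TopologicalSpace X]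
    (T : Γ →* (X ≃ₜ X)) (F : Finset Γ) (η : Γ) (x : X) {φ : X → ℝ} {C : ℝ}
    (hφ : ∀ y, |φ y| ≤ C) :
    |∑ γ ∈ F, φ (T η⁻¹ (T γ⁻¹ x)) - ∑ γ ∈ F, φ (T γ⁻¹ x)| ≤
      C * (((fun g => g * η) '' (F : Set Γ)) ∆ (F : Set Γ)).ncard := by
  classical
  have e1 : ∑ γ ∈ F, φ (T η⁻¹ (T γ⁻¹ x)) = ∑ γ ∈ F.image (· * η), φ (T γ⁻¹ x) := by
    rw [Finset.sum_image fun a _ b _ h => mul_right_cancel h]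
    refine Finset.sum_congr rfl fun γ _ => ?_
    rw [mul_inv_rev, map_mul]
    rfl
  have e2 : ((fun g => g * η) '' (F : Set Γ)) ∆ (F : Set Γ) =
      ((F.image (· * η) \ F ∪ F \ F.image (· * η) : Finset Γ) : Set Γ) := by
    simp [symmDiff_def]
  rw [e1, e2, Set.ncard_coe_finset, Finset.card_union_of_disjoint, Nat.cast_add]
  · rw [← Finset.sum_sdiff_sub_sum_sdiff]
    have bound : ∀ s : Finset Γ, |∑ γ ∈ s, φ (T γ⁻¹ x)| ≤ C * s.card := fun s =>
      (Finset.abs_sum_le_sum_abs _ _).trans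
        ((Finset.sum_le_card_nsmul _ _ C fun γ _ => hφ _).trans (by simp [mul_comm]))
    have h1 := bound (F.image (· * η) \ F)
    have h2 := bound (F \ F.image (· * η))
    refine (abs_sub _ _).trans ?_
    linarith
  · exact Finset.disjoint_left.2 fun a ha hb =>
      (Finset.mem_sdiff.1 ha).2 (Finset.mem_sdiff.1 hb).1

/-- A continuous function whose integrals against all invariant measures are less than `c`
has Følner averages eventually less than `c`, uniformly in the point. -/
theorem eventually_forall_average_lt {Γ X : Type*} [Group Γ] [MetricSpace X] [CompactSpace X]
    [MeasurableSpace X] [BorelSpace X] (T : Γ →* (X ≃ₜ X)) {F : ℕ → Finset Γ}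
    (hF : IsFolnerSeq F) (G : C(X, ℝ)) (c : ℝ)
    (hG : ∀ μ ∈ invProb T, ∫ x, G x ∂(μ : Measure X) < c) :
    ∀ᶠ n in atTop, ∀ x, ∑ γ ∈ F n, G (T γ⁻¹ x) < c * (F n).card := by
  by_contra hcon
  have hfreq : ∃ᶠ n in atTop, ∃ x, c * (F n).card ≤ ∑ γ ∈ F n, G (T γ⁻¹ x) := by
    simpa only [Filter.not_eventually, not_forall, not_lt] using hcon
  obtain ⟨k, hk, hx⟩ := extraction_of_frequently_atTop hfreq
  choose x hx using hx
  let μs : ℕ → ProbabilityMeasure X := fun n =>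
    ⟨empirical T (F (k n)) (x n), isProbabilityMeasure_empirical T (hF.nonempty _) _⟩
  -- The probability measures on `X` form a compact space, so the empirical measures at the bad
  -- points converge along a nonprincipal ultrafilter; the limit will be invariant with integral of
  -- `G` at least `c`.
  obtain ⟨μ, -, hμ⟩ := isCompact_univ.ultrafilter_le_nhds ((hyperfilter ℕ).map μs) (by simp)
  have hlim : Tendsto μs (hyperfilter ℕ) (𝓝 μ) := hμ
  have hk' : Tendsto k (hyperfilter ℕ) atTop := hk.tendsto_atTop.mono_left Nat.hyperfilter_le_atTop
  rw [ProbabilityMeasure.tendsto_iff_forall_integral_tendsto] at hlim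
  have hcard : ∀ n, (0 : ℝ) < (F (k n)).card := fun n => by
    exact_mod_cast (hF.nonempty _).card_pos
  have hinv : ∀ (η : Γ) (φ : BoundedContinuousFunction X ℝ),
      ∫ y, φ (T η⁻¹ y) ∂(μ : Measure X) = ∫ y, φ y ∂(μ : Measure X) := by
    intro η φ
    have hd := (hlim (φ.compContinuous ⟨T η⁻¹, (T η⁻¹).continuous⟩)).sub (hlim φ)
    have hz : Tendsto (fun n => ‖φ‖ * (((((fun g => g * η) '' (F (k n) : Set Γ)) ∆
        (F (k n) : Set Γ)).ncard : ℝ) / (F (k n)).card)) (hyperfilter ℕ) (𝓝 0) := by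
      simpa using ((hF.tendsto η).comp hk').const_mul ‖φ‖
    refine sub_eq_zero.1 (tendsto_nhds_unique hd (squeeze_zero_norm (fun n => ?_) hz))
    change ‖∫ y, φ (T η⁻¹ y) ∂(empirical T (F (k n)) (x n)) -
      ∫ y, φ y ∂(empirical T (F (k n)) (x n))‖ ≤ _
    rw [integral_empirical T _ _ (fun y => φ (T η⁻¹ y)),
      integral_empirical T _ _ φ, ← mul_sub, norm_mul, norm_inv, Real.norm_natCast,
      inv_mul_eq_div, Real.norm_eq_abs, ← mul_div_assoc]
    exact div_le_div_of_nonneg_right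
      (abs_average_translate_sub_le T _ η _ fun y => φ.norm_coe_le_norm y) (hcard n).le
  have hμinv : μ ∈ invProb T := by
    intro γ
    refine ⟨(T γ).continuous.measurable, ?_⟩
    have : IsProbabilityMeasure ((μ : Measure X).map (T γ)) :=
      Measure.isProbabilityMeasure_map (T γ).continuous.measurable.aemeasurable
    -- Bounded continuous functions determine a finite Borel measure here, so `hinv` suffices.
    refine ext_of_forall_integral_eq_of_IsFiniteMeasure fun φ => ?_
    rw [integral_map (T γ).continuous.measurable.aemeasurable
      φ.continuous.aestronglyMeasurable]
    simpa using hinv γ⁻¹ φ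
  refine (hG μ hμinv).not_ge (ge_of_tendsto (hlim (BoundedContinuousFunction.mkOfCompact G))
    (Eventually.of_forall fun n => ?_))
  change c ≤ ∫ y, G y ∂(empirical T (F (k n)) (x n))
  rw [integral_empirical T _ _ G, inv_mul_eq_div, le_div_iff₀ (hcard n)]
  exact hx n

theorem integral_le_integral_ordAt {X : Type*} [TopologicalSpace X] [CompactSpace X]
    [MeasurableSpace X] [BorelSpace X] {𝒱 : Finset (Set X)} (h𝒱 : 𝒱 ∈ Cov X)
    (μ : Measure X) [IsFiniteMeasure μ] (G : C(X, ℝ)) (hG : ∀ x, G x ≤ ordAt 𝒱 x) :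
    ∫ x, G x ∂μ ≤ ∫ x, ordAt 𝒱 x ∂μ := by
  refine integral_mono (BoundedContinuousFunction.integrable μ
    (BoundedContinuousFunction.mkOfCompact G)) ?_ hG
  refine (integrable_const _).add (integrable_finsetSum _ fun V hV => ?_)
  exact (integrable_const _).indicator (h𝒱.1 V hV).measurableSet

end DynDim

theorem theorem9p3 {Γ X : Type*} [Group Γ] [Countable Γ]
    [MetricSpace X] [CompactSpace X] [MeasurableSpace X] [BorelSpace X]
    (T : Γ →* (X ≃ₜ X)) (F : ℕ → Finset Γ) (hF : DynDim.IsFolnerSeq F) :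
    DynDim.mdim T F ≤ DynDim.dynDim T := by
  -- Comparing with real `c` above `dynDim T` also covers infinite values.
  refine iSup₂_le fun 𝒰 h𝒰 => EReal.le_of_forall_lt_iff_le.1 fun c hc => ?_
  have hlt : DynDim.coverDimMeas (𝒰 : Set (Set X)) (DynDim.invProb T) < c :=
    (le_iSup₂ (f := fun (𝒰 : Finset (Set X)) (_ : 𝒰 ∈ DynDim.Cov X) =>
      DynDim.coverDimMeas (𝒰 : Set (Set X)) (DynDim.invProb T)) 𝒰 h𝒰).trans_lt hc
  simp only [DynDim.coverDimMeas, iInf_lt_iff] at hlt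
  obtain ⟨𝒱, ⟨h𝒱, href⟩, hlt⟩ := hlt
  obtain ⟨f, G, hfc, hf0, hf1, hfV, hG⟩ := DynDim.exists_partition_of_mem_cov h𝒱
  have hint : ∀ μ ∈ DynDim.invProb T, ∫ x, G x ∂(μ : Measure X) < c := fun μ hμ =>
    (DynDim.integral_le_integral_ordAt h𝒱 μ G fun x => (hG x).2).trans_lt
      (EReal.coe_lt_coe_iff.1 ((le_iSup₂ (f := fun (μ : ProbabilityMeasure X)
        (_ : μ ∈ DynDim.invProb T) => ((∫ x, DynDim.ordAt 𝒱 x ∂(μ : Measure X) : ℝ) : EReal))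
        μ hμ).trans_lt hlt))
  refine limsup_le_of_le (h := ?_)
  filter_upwards [DynDim.eventually_forall_average_lt T hF G c hint] with n hn
  have hpos : (0 : EReal) < ((F n).card : EReal) := by
    exact_mod_cast (hF.nonempty n).card_pos
  rw [EReal.div_le_iff_le_mul hpos (EReal.natCast_ne_top _)]
  refine (DynDim.coverDim_joinIterates_le T (F n) href f hfc hf0 hf1 hfV G (fun x => (hG x).1)
    (c * (F n).card) fun x => (hn x).le).trans_eq ?_
  rw [mul_comm c, EReal.coe_mul, EReal.coe_natCast]
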